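/- Let $n\ge 0$. A nested sequence is a chain $\mathbf{I}=\{I_i\}_{i=1}^l$, $l\ge 1$, of subsets $\emptyset\subsetneq I_1\subsetneq I_2\subsetneq\cdots\subsetneq I_l\subsetneq\{1,\ldots,n+1\}$; nested sequences are partially ordered by declaring $\mathbf{I}\le\mathbf{I}'$ if and only if $\mathbf{I}'\subset\mathbf{I}$. Let $P_n$ be an $n$-dimensional permutahedron, that is, a nonempty $n$-dimensional convex polytope together with an isomorphism $\mathbf{I}\mapsto F_{\mathbf{I}}$ from the poset of nested sequences to the poset of nonempty proper faces of $P_n$, ordered by inclusion. (For example, $P_n$ may be the convex hull in $\mathbb{R}^{n+1}$ of all permutations of $(1,2,\ldots,n+1)$, with $F_{\mathbf{I}}$ the set of $x\in P_n$ such that $\sum_{i\in I}x_i=1+2+\cdots+|I|$ for all $I\in\mathbf{I}$.) Let $\Delta_n$ be an $n$-simplex with vertices $p_1,\ldots,p_{n+1}$ and, for a nonempty proper subset $I\subset\{1,\ldots,n+1\}$, let $F_I\subset\partial\Delta_n$ be the face of codimension $|I|$ spanned by the vertices $p_i$ with $i\notin I$, so that $F_I\subset F_J$ if and only if $J\subset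 I$. Let $f:P_n\to\Delta_n$ be a continuous map such that for every nested sequence $\mathbf{I}=\{I_i\}_{i=1}^l$ we have $f(F_{\mathbf{I}})\subset F_{I_l}$, where $I_l$ is the largest subset in $\mathbf{I}$. Then $f$ is surjective. -/

import Mathlib

/-- A nested sequence `∅ ⊊ I₁ ⊊ I₂ ⊊ ⋯ ⊊ I_l ⊊ {1, …, n+1}` with `l ≥ 1`, recorded as the set
`{I₁, …, I_l}`: a nonempty finite chain of nonempty proper subsets of an `(n+1)`-element set. -/
@[ext]
structure NestedSeq (n : ℕ) where
  sets : Finset (Finset (Fin (n + 1)))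
  nonempty : sets.Nonempty
  chain : ∀ I ∈ sets, ∀ J ∈ sets, I ⊆ J ∨ J ⊆ I
  ne_empty : ∀ I ∈ sets, I ≠ ∅
  ne_univ : ∀ I ∈ sets, I ≠ Finset.univ

namespace NestedSeq

variable {n : ℕ}

/-- The order on nested sequences: `𝐈 ≤ 𝐉` if and only if `𝐉 ⊆ 𝐈`. -/
instance : PartialOrder (NestedSeq n) where
  le I J := J.sets ⊆ I.sets
  le_refl _ := Finset.Subset.refl _
  le_trans _ _ _ h₁ h₂ := Finset.Subset.trans h₂ h₁
  le_antisymm _ _ h₁ h₂ := NestedSeq.ext (Finset.Subset.antisymm h₂ h₁)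

/-- The largest subset `I_l` of a nested sequence (the union of a chain is its largest member). -/
def largest (I : NestedSeq n) : Finset (Fin (n + 1)) := I.sets.sup id

theorem largest_mem (I : NestedSeq n) : I.largest ∈ I.sets := by
  have hd : ∀ s : Finset (Finset (Fin (n + 1))), s.Nonempty →
      (∀ I ∈ s, ∀ J ∈ s, I ⊆ J ∨ J ⊆ I) → s.sup id ∈ s := by
    intro s hs hc
    obtain ⟨M, hM, hmax⟩ := s.exists_max_image Finset.card hs
    have : s.sup id = M := by
      apply le_antisymm
      · refine Finset.sup_le fun J hJ => ?_
        rcases hc J hJ M hM with h | h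
        · exact h
        · exact (Finset.eq_of_subset_of_card_le h (hmax J hJ)).ge
      · exact Finset.le_sup (f := id) hM
    rw [this]; exact hM
  exact hd _ I.nonempty I.chain

theorem subset_largest (I : NestedSeq n) {J : Finset (Fin (n + 1))} (hJ : J ∈ I.sets) : J ⊆ I.largest :=
  Finset.le_sup (f := id) hJ

end NestedSeq

/-- The nonempty proper faces of a convex polytope `P` (the nonempty subsets, different from `P`,
on which some linear functional attains its maximum over `P`), ordered by inclusion. -/
abbrev ProperFace {E : Type*} [NormedAddCommGroup E] [NormedSpace ℝ E] (P : Set E) : Type _ :=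
  {F : Set E // IsExposed ℝ P F ∧ F.Nonempty ∧ F ≠ P}

/-- An `n`-dimensional permutahedron in `E`: an `n`-dimensional convex polytope together with a
labelling of its nonempty proper faces by nested sequences which is an isomorphism of posets. -/
structure Permutahedron (n : ℕ) (E : Type*) [NormedAddCommGroup E] [NormedSpace ℝ E] where
  carrier : Set E
  isPolytope : ∃ s : Set E, s.Finite ∧ carrier = convexHull ℝ s
  nonempty : carrier.Nonempty
  finrank_eq : Module.finrank ℝ (vectorSpan ℝ carrier) = n
  labelling : NestedSeq n ≃o ProperFace carrier

/-- The face `F_𝐈` of a permutahedron labelled by the nested sequence `𝐈`. -/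
def Permutahedron.face {n : ℕ} {E : Type*} [NormedAddCommGroup E] [NormedSpace ℝ E]
    (P : Permutahedron n E) (I : NestedSeq n) : Set E :=
  (P.labelling I : Set E)

/-- The `n`-simplex with given (affinely independent) vertices. -/
def simplexBody {n : ℕ} {V : Type*} [NormedAddCommGroup V] [NormedSpace ℝ V]
    (s : Affine.Simplex ℝ V n) : Set V :=
  convexHull ℝ (Set.range s.points)

/-- The face `F_I` of an `n`-simplex: the intersection of the facets with labels in `I`, where the
`i`-th facet is the one opposite to the `i`-th vertex. It has codimension `|I|`, and its vertices
are those with labels outside `I`. -/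
def simplexFace {n : ℕ} {V : Type*} [NormedAddCommGroup V] [NormedSpace ℝ V]
    (s : Affine.Simplex ℝ V n) (I : Finset (Fin (n + 1))) : Set V :=
  convexHull ℝ (s.points '' {i | i ∉ I})

/-! The rest of this file constructs the standard permutahedron, the convex hull of all
permutations of `(1, 2, …, n+1)`, as an example of the structure `Permutahedron`. -/

namespace StdPermutahedron

variable {n : ℕ}

/-- The vertex of the standard permutahedron given by a permutation. -/
def vert (σ : Equiv.Perm (Fin (n + 1))) : Fin (n + 1) → ℝ := fun i => ((σ i : ℕ) : ℝ) + 1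

/-- The convex hull of all permutations of `(1, 2, …, n+1)` in `ℝ^(n+1)`. -/
def body (n : ℕ) : Set (Fin (n + 1) → ℝ) := convexHull ℝ (Set.range vert)

/-- The minimum `1 + 2 + ⋯ + |I|` of the coordinate sum over `I` on the standard permutahedron. -/
noncomputable def bd (I : Finset (Fin (n + 1))) : ℝ := (I.card : ℝ) * ((I.card : ℝ) + 1) / 2

/-- The points of the standard permutahedron where, for every `I` in the given collection, the
coordinate sum over `I` is minimal. -/
def faceSet (C : Finset (Finset (Fin (n + 1)))) : Set (Fin (n + 1) → ℝ) :=
  {x | x ∈ body n ∧ ∀ I ∈ C, ∑ i ∈ I, x i = bd I}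

theorem vert_mem (σ : Equiv.Perm (Fin (n + 1))) : vert σ ∈ body n :=
  subset_convexHull ℝ _ ⟨σ, rfl⟩

theorem vert_apply (σ : Equiv.Perm (Fin (n + 1))) (i : Fin (n + 1)) :
    vert σ i = ∑ j, if σ j ≤ σ i then (1 : ℝ) else 0 := by
  rw [Equiv.sum_comp σ (fun k => if k ≤ σ i then (1 : ℝ) else 0), Finset.sum_boole]
  have : (Finset.univ.filter fun k => k ≤ σ i) = Finset.Iic (σ i) := by ext; simp
  rw [this, Fin.card_Iic]
  simp [vert]

theorem sum_vert (σ : Equiv.Perm (Fin (n + 1))) (I : Finset (Fin (n + 1))) :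
    ∑ i ∈ I, vert σ i = bd I + ∑ i ∈ I, ∑ j ∈ Iᶜ, if σ j < σ i then (1 : ℝ) else 0 := by
  have h1 : ∀ i ∈ I, vert σ i = (∑ j ∈ I, if σ j ≤ σ i then (1 : ℝ) else 0) +
      ∑ j ∈ Iᶜ, if σ j < σ i then (1 : ℝ) else 0 := by
    intro i hi
    rw [vert_apply, ← Finset.sum_add_sum_compl I]
    congr 1
    refine Finset.sum_congr rfl fun j hj => ?_
    have hne : σ j ≠ σ i := fun h => (Finset.mem_compl.1 hj) (σ.injective h ▸ hi)
    simp only [le_iff_lt_or_eq, hne, or_false]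
  rw [Finset.sum_congr rfl h1, Finset.sum_add_distrib]
  congr 1
  have h2 : (∑ i ∈ I, ∑ j ∈ I, if σ j ≤ σ i then (1 : ℝ) else 0) +
      (∑ i ∈ I, ∑ j ∈ I, if σ j ≤ σ i then (1 : ℝ) else 0) =
      ∑ i ∈ I, ∑ j ∈ I, (1 + if i = j then (1 : ℝ) else 0) := by
    conv_lhs => arg 2; rw [Finset.sum_comm]
    rw [← Finset.sum_add_distrib]
    refine Finset.sum_congr rfl fun i _ => ?_
    rw [← Finset.sum_add_distrib]
    refine Finset.sum_congr rfl fun j _ => ?_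
    by_cases hij : i = j
    · subst hij; simp
    · have hne : σ i ≠ σ j := fun h => hij (σ.injective h)
      rcases lt_or_gt_of_ne hne with h | h
      · simp [hij, h.le, not_le.2 h]
      · simp [hij, h.le, not_le.2 h]
  have h3 : ∑ i ∈ I, ∑ j ∈ I, (1 + if i = j then (1 : ℝ) else 0) =
      (I.card : ℝ) * ((I.card : ℝ) + 1) := by
    have : ∀ i ∈ I, ∑ j ∈ I, (1 + if i = j then (1 : ℝ) else 0) = (I.card : ℝ) + 1 := by
      intro i hi
      rw [Finset.sum_add_distrib]
      simp [hi]
    rw [Finset.sum_congr rfl this]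
    simp [mul_add]
  rw [h3] at h2
  unfold bd
  linarith

theorem bd_le_vert (σ : Equiv.Perm (Fin (n + 1))) (I : Finset (Fin (n + 1))) :
    bd I ≤ ∑ i ∈ I, vert σ i := by
  rw [sum_vert]
  have : 0 ≤ ∑ i ∈ I, ∑ j ∈ Iᶜ, if σ j < σ i then (1 : ℝ) else 0 :=
    Finset.sum_nonneg fun i _ => Finset.sum_nonneg fun j _ => by split_ifs <;> norm_num
  linarith

theorem vert_eq_iff (σ : Equiv.Perm (Fin (n + 1))) (I : Finset (Fin (n + 1))) :
    ∑ i ∈ I, vert σ i = bd I ↔ ∀ i ∈ I, ∀ j ∉ I, ¬ σ j < σ i := by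
  rw [sum_vert, add_eq_left, Finset.sum_eq_zero_iff_of_nonneg
    (fun i _ => Finset.sum_nonneg fun j _ => by split_ifs <;> norm_num)]
  refine forall₂_congr fun i _ => ?_
  rw [Finset.sum_eq_zero_iff_of_nonneg (fun j _ => by split_ifs <;> norm_num)]
  simp

theorem bd_le {x : Fin (n + 1) → ℝ} (hx : x ∈ body n) (I : Finset (Fin (n + 1))) :
    bd I ≤ ∑ i ∈ I, x i := by
  have hconv : Convex ℝ {x : Fin (n + 1) → ℝ | bd I ≤ ∑ i ∈ I, x i} := by
    refine convex_halfSpace_ge (f := fun x : Fin (n + 1) → ℝ => ∑ i ∈ I, x i) ⟨?_, ?_⟩ _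
    · intro x y; simp [Finset.sum_add_distrib]
    · intro c x; simp [Finset.mul_sum]
  exact convexHull_min (by rintro _ ⟨σ, rfl⟩; exact bd_le_vert σ I) hconv hx

theorem sum_univ {x : Fin (n + 1) → ℝ} (hx : x ∈ body n) :
    ∑ i, x i = bd (Finset.univ : Finset (Fin (n + 1))) := by
  have hconv : Convex ℝ {x : Fin (n + 1) → ℝ | ∑ i, x i = bd (Finset.univ : Finset (Fin (n + 1)))} := by
    refine convex_hyperplane (f := fun x : Fin (n + 1) → ℝ => ∑ i, x i) ⟨?_, ?_⟩ _
    · intro x y; simp [Finset.sum_add_distrib]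
    · intro c x; simp [Finset.mul_sum]
  refine convexHull_min ?_ hconv hx
  rintro _ ⟨σ, rfl⟩
  simpa using (vert_eq_iff σ Finset.univ).2 (by simp)

/-- A permutation that sorts the indices by the values of `r`. -/
theorem exists_sort (r : Fin (n + 1) → ℕ) :
    ∃ σ : Equiv.Perm (Fin (n + 1)), ∀ i j, σ i ≤ σ j → r i ≤ r j := by
  refine ⟨(Tuple.sort r)⁻¹, fun i j h => ?_⟩
  simpa using Tuple.monotone_sort r h

/-- The number of members of the collection `C` that do not contain `i`. -/
def rk (C : Finset (Finset (Fin (n + 1)))) (i : Fin (n + 1)) : ℕ := (C.filter fun I => i ∉ I).card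

theorem rk_lt {C : Finset (Finset (Fin (n + 1)))} (hC : ∀ I ∈ C, ∀ J ∈ C, I ⊆ J ∨ J ⊆ I)
    {I : Finset (Fin (n + 1))} (hI : I ∈ C) {i j : Fin (n + 1)} (hi : i ∈ I) (hj : j ∉ I) :
    rk C i < rk C j := by
  apply Finset.card_lt_card
  rw [Finset.ssubset_iff_of_subset]
  · exact ⟨I, by simp [hI, hj], by simp [hi]⟩
  · intro K hK
    rw [Finset.mem_filter] at hK ⊢
    refine ⟨hK.1, fun hjK => ?_⟩
    rcases hC K hK.1 I hI with h | h
    · exact hj (h hjK)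
    · exact hK.2 (h hi)

theorem exists_adapted {C : Finset (Finset (Fin (n + 1)))}
    (hC : ∀ I ∈ C, ∀ J ∈ C, I ⊆ J ∨ J ⊆ I) {J : Finset (Fin (n + 1))} (hJ : J ∉ C)
    (hJ0 : J ≠ ∅) (hJ1 : J ≠ Finset.univ) :
    ∃ σ : Equiv.Perm (Fin (n + 1)), vert σ ∈ faceSet C ∧ ∑ i ∈ J, vert σ i ≠ bd J := by
  obtain ⟨σ, hσ⟩ := exists_sort (fun i => 2 * rk C i + if i ∈ J then 1 else 0)
  refine ⟨σ, ⟨vert_mem σ, fun I hI => ?_⟩, fun h => ?_⟩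
  · rw [vert_eq_iff]
    intro i hi j hj hlt
    have h1 := hσ j i hlt.le
    have h2 := rk_lt hC hI hi hj
    split_ifs at h1 <;> omega
  · rw [vert_eq_iff] at h
    have key : ∀ i ∈ J, ∀ j ∉ J, rk C i < rk C j := by
      intro i hi j hj
      have h1 := hσ i j (not_lt.1 (h i hi j hj))
      simp only [hi, hj, if_true, if_false] at h1
      omega
    obtain ⟨i0, hi0, himax⟩ := J.exists_max_image (rk C) (Finset.nonempty_iff_ne_empty.2 hJ0)
    have hne : (Jᶜ).Nonempty := by
      rw [Finset.nonempty_iff_ne_empty, Ne, Finset.compl_eq_empty_iff]; exact hJ1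
    obtain ⟨j0, hj0, hjmin⟩ := (Jᶜ).exists_min_image (rk C) hne
    have hlt := key i0 hi0 j0 (Finset.mem_compl.1 hj0)
    obtain ⟨I, hI, hI'⟩ := Finset.exists_mem_notMem_of_card_lt_card hlt
    rw [Finset.mem_filter] at hI
    have hi0I : i0 ∈ I := by
      by_contra hcon
      exact hI' (Finset.mem_filter.2 ⟨hI.1, hcon⟩)
    apply hJ
    have : J = I := by
      ext k
      constructor
      · intro hk
        by_contra hkI
        exact absurd (rk_lt hC hI.1 hi0I hkI) (not_lt.2 (himax k hk))
      · intro hk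
        by_contra hkJ
        exact absurd (rk_lt hC hI.1 hk hI.2) (not_lt.2 (hjmin k (Finset.mem_compl.2 hkJ)))
    rw [this]; exact hI.1

theorem faceSet_nonempty {C : Finset (Finset (Fin (n + 1)))}
    (hC : ∀ I ∈ C, ∀ J ∈ C, I ⊆ J ∨ J ⊆ I) : (faceSet C).Nonempty := by
  obtain ⟨σ, hσ⟩ := exists_sort (rk C)
  refine ⟨vert σ, vert_mem σ, fun I hI => ?_⟩
  rw [vert_eq_iff]
  intro i hi j hj hlt
  exact absurd (rk_lt hC hI hi hj) (not_lt.2 (hσ j i hlt.le))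

/-- A functional that is, up to a constant on the polytope, a negative combination of the
coordinate sums over the members of a chain is maximal exactly on the corresponding face. -/
theorem maximizers_eq {C : Finset (Finset (Fin (n + 1)))}
    (hC : ∀ I ∈ C, ∀ J ∈ C, I ⊆ J ∨ J ⊆ I) (c : Finset (Fin (n + 1)) → ℝ) (hc : ∀ I ∈ C, 0 < c I)
    (K : ℝ) (l : (Fin (n + 1) → ℝ) → ℝ)
    (hl : ∀ x ∈ body n, l x = K - ∑ I ∈ C, c I * ∑ i ∈ I, x i) :
    {x | x ∈ body n ∧ ∀ y ∈ body n, l y ≤ l x} = faceSet C := by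
  ext x
  constructor
  · rintro ⟨hx, hmax⟩
    refine ⟨hx, ?_⟩
    obtain ⟨x0, hx0, hx0'⟩ := faceSet_nonempty hC
    have h1 := hmax x0 hx0
    rw [hl x hx, hl x0 hx0] at h1
    have h2 : ∑ I ∈ C, c I * (∑ i ∈ I, x i - bd I) ≤ 0 := by
      have : ∑ I ∈ C, c I * ∑ i ∈ I, x0 i = ∑ I ∈ C, c I * bd I :=
        Finset.sum_congr rfl fun I hI => by rw [hx0' I hI]
      simp only [mul_sub, Finset.sum_sub_distrib]
      linarith
    have h3 : ∀ I ∈ C, 0 ≤ c I * (∑ i ∈ I, x i - bd I) := fun I hI =>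
      mul_nonneg (hc I hI).le (sub_nonneg.2 (bd_le hx I))
    have h4 := (Finset.sum_eq_zero_iff_of_nonneg h3).1 (le_antisymm h2 (Finset.sum_nonneg h3))
    intro I hI
    have := (mul_eq_zero.1 (h4 I hI)).resolve_left (hc I hI).ne'
    linarith
  · rintro ⟨hx, hx'⟩
    refine ⟨hx, fun y hy => ?_⟩
    rw [hl x hx, hl y hy]
    apply sub_le_sub_left
    refine Finset.sum_le_sum fun I hI => ?_
    rw [hx' I hI]
    exact mul_le_mul_of_nonneg_left (bd_le hy I) (hc I hI).le

/-- Every weight vector is a constant minus a positive combination of the indicators of its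
proper sublevel sets. -/
theorem exists_layers (m : ℕ) (a : Fin (n + 1) → ℝ) (hm : (Finset.univ.image a).card ≤ m) :
    ∃ (C : Finset (Finset (Fin (n + 1)))) (c : Finset (Fin (n + 1)) → ℝ) (K : ℝ),
      (∀ I ∈ C, I ≠ ∅ ∧ I ≠ Finset.univ ∧ ∃ t, I = Finset.univ.filter fun i => a i ≤ t) ∧
      (∀ I ∈ C, 0 < c I) ∧ ∀ i, a i = K - ∑ I ∈ C, c I * if i ∈ I then 1 else 0 := by
  induction m generalizing a with
  | zero =>
    have := Finset.card_pos.2 ((Finset.univ_nonempty (α := Fin (n + 1))).image a)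
    omega
  | succ m ih =>
    obtain ⟨k, -, hk⟩ := Finset.univ.exists_max_image a Finset.univ_nonempty
    by_cases hconst : ∀ i, a i = a k
    · exact ⟨∅, 0, a k, by simp, by simp, by simpa using hconst⟩
    push Not at hconst
    obtain ⟨i1, hi1⟩ := hconst
    have hi1' : a i1 < a k := lt_of_le_of_ne (hk i1 (Finset.mem_univ _)) hi1
    set S : Finset (Fin (n + 1)) := Finset.univ.filter fun i => a i < a k with hS
    have hi1S : i1 ∈ S := by simp [hS, hi1']
    obtain ⟨q, hq, hqmax⟩ := S.exists_max_image a ⟨i1, hi1S⟩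
    have hqk : a q < a k := (Finset.mem_filter.1 hq).2
    have hmin : ∀ i, (a i < a k ∧ min (a i) (a q) = a i ∧ i ∈ S) ∨
        (a i = a k ∧ min (a i) (a q) = a q ∧ i ∉ S) := by
      intro i
      rcases lt_or_eq_of_le (hk i (Finset.mem_univ _)) with h | h
      · have hiS : i ∈ S := by simp [hS, h]
        exact Or.inl ⟨h, min_eq_left (hqmax i hiS), hiS⟩
      · exact Or.inr ⟨h, min_eq_right (h ▸ hqk.le), by simp [hS, h]⟩
    have hcard : (Finset.univ.image fun i => min (a i) (a q)).card ≤ m := by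
      have hss : (Finset.univ.image fun i => min (a i) (a q)) ⊂ Finset.univ.image a := by
        rw [Finset.ssubset_iff_of_subset]
        · refine ⟨a k, Finset.mem_image_of_mem _ (Finset.mem_univ _), ?_⟩
          intro h
          obtain ⟨i, -, hi⟩ := Finset.mem_image.1 h
          have := min_le_right (a i) (a q)
          linarith
        · intro y hy
          obtain ⟨i, -, rfl⟩ := Finset.mem_image.1 hy
          rcases min_choice (a i) (a q) with h | h
          · rw [h]; exact Finset.mem_image_of_mem _ (Finset.mem_univ _)
          · rw [h]; exact Finset.mem_image_of_mem _ (Finset.mem_univ _)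
      have := Finset.card_lt_card hss
      omega
    obtain ⟨C, c, K, hC, hc, hK⟩ := ih (fun i => min (a i) (a q)) hcard
    have hlev : ∀ I ∈ C, ∃ t, t < a q ∧ I = Finset.univ.filter fun i => a i ≤ t := by
      intro I hI
      obtain ⟨-, hne, t, ht⟩ := hC I hI
      have htq : t < a q := by
        by_contra hcon
        apply hne
        rw [ht]
        exact Finset.filter_true_of_mem fun i _ => (min_le_right _ _).trans (not_lt.1 hcon)
      refine ⟨t, htq, ?_⟩
      rw [ht]
      ext i
      simp only [Finset.mem_filter, Finset.mem_univ, true_and, min_le_iff]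
      exact or_iff_left (not_le.2 htq)
    have hSC : S ∉ C := by
      intro h
      obtain ⟨t, htq, ht⟩ := hlev S h
      rw [ht] at hq
      exact absurd (Finset.mem_filter.1 hq).2 (not_le.2 htq)
    refine ⟨insert S C, fun I => if I = S then a k - a q else c I, K + (a k - a q), ?_, ?_, ?_⟩
    · intro I hI
      rcases Finset.mem_insert.1 hI with rfl | hI
      · refine ⟨Finset.ne_empty_of_mem hi1S, fun h => ?_, a q, ?_⟩
        · have : k ∈ S := h ▸ Finset.mem_univ k
          exact lt_irrefl _ (Finset.mem_filter.1 this).2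
        · ext i
          simp only [Finset.mem_filter, Finset.mem_univ, true_and]
          constructor
          · intro hi
            exact hqmax i hi
          · intro hi
            rw [hS]; simpa using hi.trans_lt hqk
      · obtain ⟨t, -, ht⟩ := hlev I hI
        exact ⟨(hC I hI).1, (hC I hI).2.1, t, ht⟩
    · intro I hI
      dsimp only
      split_ifs with h
      · linarith
      · exact hc I ((Finset.mem_insert.1 hI).resolve_left h)
    · intro i
      rw [Finset.sum_insert hSC]
      have hsum : ∑ I ∈ C, (if I = S then a k - a q else c I) * (if i ∈ I then (1 : ℝ) else 0) =
          ∑ I ∈ C, c I * if i ∈ I then 1 else 0 := by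
        refine Finset.sum_congr rfl fun I hI => ?_
        rw [if_neg (by rintro rfl; exact hSC hI)]
      beta_reduce
      rw [hsum, if_pos rfl]
      have hKi := hK i
      rcases hmin i with ⟨h1, h2, h3⟩ | ⟨h1, h2, h3⟩
      · rw [if_pos h3]
        linarith
      · rw [if_neg h3]
        linarith

theorem sum_indicator (C : Finset (Finset (Fin (n + 1)))) (c : Finset (Fin (n + 1)) → ℝ) (K : ℝ)
    (x : Fin (n + 1) → ℝ) :
    ∑ i, x i * (K - ∑ I ∈ C, c I * if i ∈ I then 1 else 0) =
      K * ∑ i, x i - ∑ I ∈ C, c I * ∑ i ∈ I, x i := by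
  simp only [mul_sub, Finset.sum_sub_distrib]
  congr 1
  · rw [Finset.mul_sum]; exact Finset.sum_congr rfl fun i _ => mul_comm _ _
  · simp only [Finset.mul_sum]
    rw [Finset.sum_comm]
    refine Finset.sum_congr rfl fun I _ => ?_
    simp [Finset.sum_ite_mem, mul_comm]

theorem faceSet_isExposed {C : Finset (Finset (Fin (n + 1)))}
    (hC : ∀ I ∈ C, ∀ J ∈ C, I ⊆ J ∨ J ⊆ I) : IsExposed ℝ (body n) (faceSet C) := by
  intro _
  refine ⟨-∑ I ∈ C, ∑ i ∈ I, ContinuousLinearMap.proj i, ?_⟩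
  refine (maximizers_eq hC (fun _ => 1) (by simp) 0 _ fun x _ => ?_).symm
  simp

theorem faceSet_ne_body {C : Finset (Finset (Fin (n + 1)))} (h0 : C.Nonempty)
    (hne : ∀ I ∈ C, I ≠ ∅) (hnu : ∀ I ∈ C, I ≠ Finset.univ) : faceSet C ≠ body n := by
  obtain ⟨I, hI⟩ := h0
  intro h
  obtain ⟨σ, -, hσ⟩ := exists_adapted (C := ∅) (by simp) (Finset.notMem_empty I) (hne I hI)
    (hnu I hI)
  have : vert σ ∈ faceSet C := h ▸ vert_mem σ
  exact hσ (this.2 I hI)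

/-- The face of the standard permutahedron labelled by a nested sequence. -/
def toFace (I : NestedSeq n) : ProperFace (body n) :=
  ⟨faceSet I.sets, faceSet_isExposed I.chain, faceSet_nonempty I.chain,
    faceSet_ne_body I.nonempty I.ne_empty I.ne_univ⟩

theorem toFace_le_iff (I J : NestedSeq n) : toFace I ≤ toFace J ↔ I ≤ J := by
  constructor
  · intro h A hA
    by_contra hAI
    obtain ⟨σ, h1, h2⟩ := exists_adapted I.chain hAI (J.ne_empty A hA) (J.ne_univ A hA)
    have h3 : vert σ ∈ faceSet J.sets := h h1
    exact h2 (h3.2 A hA)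
  · intro h x hx
    exact ⟨hx.1, fun A hA => hx.2 A (h hA)⟩

theorem toFace_surjective : Function.Surjective (toFace (n := n)) := by
  rintro ⟨F, hF, hne, hprop⟩
  obtain ⟨l, hl⟩ := hF hne
  obtain ⟨C, c, K, hC, hc, hK⟩ :=
    exists_layers _ (fun i => l (fun j => if i = j then 1 else 0)) le_rfl
  have hl' : ∀ x ∈ body n,
      l x = K * bd (Finset.univ : Finset (Fin (n + 1))) - ∑ I ∈ C, c I * ∑ i ∈ I, x i := by
    intro x hx
    have h1 : l x = ∑ i, x i * l (fun j => if i = j then 1 else 0) := by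
      simpa using LinearMap.pi_apply_eq_sum_univ (l : (Fin (n + 1) → ℝ) →ₗ[ℝ] ℝ) x
    rw [h1, ← sum_univ hx, ← sum_indicator]
    exact Finset.sum_congr rfl fun i _ => by rw [← hK i]
  have hchain : ∀ I ∈ C, ∀ J ∈ C, I ⊆ J ∨ J ⊆ I := by
    intro I hI J hJ
    obtain ⟨-, -, s, rfl⟩ := hC I hI
    obtain ⟨-, -, t, rfl⟩ := hC J hJ
    rcases le_total s t with h | h
    · left
      intro i hi
      simp only [Finset.mem_filter, Finset.mem_univ, true_and] at hi ⊢
      exact hi.trans h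
    · right
      intro i hi
      simp only [Finset.mem_filter, Finset.mem_univ, true_and] at hi ⊢
      exact hi.trans h
  have hFC : F = faceSet C := by
    rw [hl]
    exact maximizers_eq hchain c hc _ l hl'
  have hCne : C.Nonempty := by
    rw [Finset.nonempty_iff_ne_empty]
    rintro rfl
    exact hprop (hFC.trans (by ext x; simp [faceSet]))
  exact ⟨⟨C, hCne, hchain, fun I hI => (hC I hI).1, fun I hI => (hC I hI).2.1⟩,
    Subtype.ext hFC.symm⟩

theorem finrank_body : Module.finrank ℝ (vectorSpan ℝ (body n)) = n := by
  let S : (Fin (n + 1) → ℝ) →ₗ[ℝ] ℝ := ∑ i, LinearMap.proj i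
  have hS : ∀ x, S x = ∑ i, x i := fun x => by simp [S]
  have hspan : vectorSpan ℝ (body n) = LinearMap.ker S := by
    apply le_antisymm
    · rw [vectorSpan, Submodule.span_le]
      rintro _ ⟨x, hx, y, hy, rfl⟩
      simp only [SetLike.mem_coe, LinearMap.mem_ker, hS]
      simp [Finset.sum_sub_distrib, sum_univ hx, sum_univ hy]
    · have hdiff : ∀ i : Fin (n + 1),
          (Pi.single i 1 - Pi.single 0 1 : Fin (n + 1) → ℝ) ∈ vectorSpan ℝ (body n) := by
        intro i
        by_cases hi : i = 0
        · subst hi; simp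
        have h := vsub_mem_vectorSpan ℝ (vert_mem (Equiv.swap i 0)) (vert_mem (Equiv.refl _))
        have h2 := (vectorSpan ℝ (body n)).smul_mem (-(((i : ℕ) : ℝ))⁻¹) h
        have hi0 : ((i : ℕ) : ℝ) ≠ 0 := by
          exact Nat.cast_ne_zero.2 fun h0 => hi (Fin.ext h0)
        convert h2 using 1
        ext j
        by_cases h0 : j = 0
        · subst h0
          have hs : (Pi.single i 1 : Fin (n + 1) → ℝ) 0 = 0 := Pi.single_eq_of_ne (Ne.symm hi) _
          simp only [vert, Pi.sub_apply, Pi.smul_apply, vsub_eq_sub, hs, Pi.single_eq_same,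
            Equiv.swap_apply_right, Equiv.refl_apply, smul_eq_mul, Fin.val_zero, Nat.cast_zero]
          field_simp
          ring
        by_cases hj : j = i
        · subst hj
          simp [vert, h0, hi0]
        · simp [vert, h0, hj, Equiv.swap_apply_of_ne_of_ne hj h0]
      intro x hx
      rw [LinearMap.mem_ker, hS] at hx
      have : x = ∑ i, x i • (Pi.single i 1 - Pi.single 0 1 : Fin (n + 1) → ℝ) := by
        simp only [smul_sub, Finset.sum_sub_distrib, ← Finset.sum_smul, hx, zero_smul, sub_zero]
        exact pi_eq_sum_univ' x
      rw [this]
      exact Submodule.sum_mem _ fun i _ => Submodule.smul_mem _ _ (hdiff i)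
  have hrange : LinearMap.range S = ⊤ := by
    rw [LinearMap.range_eq_top]
    intro t
    exact ⟨Pi.single 0 t, by simp [hS]⟩
  have := LinearMap.finrank_range_add_finrank_ker S
  rw [hrange, finrank_top] at this
  simp at this
  rw [hspan]
  omega

end StdPermutahedron

/-- The standard permutahedron: the convex hull of all permutations of `(1, 2, …, n+1)`, where the
face labelled by `𝐈` is the set of points at which, for all `I ∈ 𝐈`, the sum of the coordinates
with indices in `I` has its minimal value `1 + 2 + ⋯ + |I|`. -/
noncomputable def standardPermutahedron (n : ℕ) : Permutahedron n (Fin (n + 1) → ℝ) where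
  carrier := StdPermutahedron.body n
  isPolytope := ⟨_, Set.finite_range _, rfl⟩
  nonempty := ⟨_, StdPermutahedron.vert_mem 1⟩
  finrank_eq := StdPermutahedron.finrank_body
  labelling := RelIso.ofSurjective
    (OrderEmbedding.ofMapLEIff StdPermutahedron.toFace StdPermutahedron.toFace_le_iff)
    StdPermutahedron.toFace_surjective

/-!
At a point `x` of the standard simplex, the sets `J` such that the coordinates in `J` are smaller
than all the others form a chain, so the faces of the permutahedron labelled by those `J` have a
common point. Averaging such points with continuous weights gives a continuous map `g` from the
simplex to the permutahedron such that, for `x` in the boundary, `g x` lies in a face labelled by a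
set containing all the `i` with `x i = 0`. In barycentric coordinates, `f ∘ g` is then a self-map of
the simplex preserving every facet, and it suffices to see that such a map `h` is surjective.

Given `y`, the closed sets `{x | h x i ≤ y i}` cover the simplex, and the `i`-th one contains the
facet `x i = 0`. By the Alexandroff–Pasynkoff theorem they have a common point, and there `h x = y`.
The latter theorem is the limit, along finite sets of points of the simplex, of a combinatorial
lemma of Scarf: given a function `u i` and a colour `i` for each `i` in `ι`, and a finite set `T` of
coloured points, there are points of different colours such that no point of `T` exceeds the least
of them in `u i` for all these colours `i`. It is proved by the parity argument of Sperner's lemma,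
with Scarf's primitive sets as the simplices: among the facets with all colours but one, a single
one lies in exactly one primitive set, and every other one lies in two or in none.
-/

section Scarf

open Finset Function

variable {ι α L : Type*} [LinearOrder L] {u : ι → α → L}

/-- A finite set `B` is dominant for the utilities `u` if no `y` is, for every `i`, strictly better
than the worst member of `B`. -/
def IsDominantSet (u : ι → α → L) (B : Finset α) : Prop :=
  ∀ y, ∃ i, ∀ x ∈ B, u i y ≤ u i x

/-- Scarf's primitive sets: the dominant sets with as many members as there are utilities. They play
the role of the top-dimensional simplices of a triangulation. -/
def IsPrimitiveSet [Fintype ι] (u : ι → α → L) (B : Finset α) : Prop :=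
  IsDominantSet u B ∧ #B = Fintype.card ι

/-- `t i` is a worst point of `B` for the utility `u i`, for every `i`. -/
def IsWorstSelection (u : ι → α → L) (B : Finset α) (t : ι → α) : Prop :=
  ∀ i, t i ∈ B ∧ ∀ x ∈ B, u i (t i) ≤ u i x

/-- An apex in direction `k` over a set with worst points `t`: a best point for `u k` among those
that are strictly better than the set in all the other directions. The primitive sets containing a
given facet are obtained by adding an apex. -/
def IsApex (u : ι → α → L) (t : ι → α) (k : ι) (x : α) : Prop :=
  (∀ l ≠ k, u l (t l) < u l x) ∧ ∀ y, (∀ l ≠ k, u l (t l) < u l y) → u k y ≤ u k x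

theorem IsDominantSet.mono {τ B : Finset α} (hB : IsDominantSet u B) (h : τ ⊆ B) :
    IsDominantSet u τ := fun y =>
  let ⟨i, hi⟩ := hB y
  ⟨i, fun x hx => hi x (h hx)⟩

theorem exists_isWorstSelection {B : Finset α} (hB : B.Nonempty) :
    ∃ t, IsWorstSelection u B t := by
  choose t ht using fun i => B.exists_min_image (u i) hB
  exact ⟨t, ht⟩

theorem IsDominantSet.exists_eq_of_mem {B : Finset α} {t : ι → α} (hu : ∀ i, Injective (u i))
    (hB : IsDominantSet u B) (ht : IsWorstSelection u B t) {x : α} (hx : x ∈ B) :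
    ∃ i, t i = x := by
  obtain ⟨i, hi⟩ := hB x
  exact ⟨i, hu i (((ht i).2 x hx).antisymm (hi _ (ht i).1))⟩

theorem IsWorstSelection.eq_of_insert [DecidableEq α] {τ : Finset α} {t b : ι → α} {x : α} {i : ι}
    (hu : ∀ i, Injective (u i)) (ht : IsWorstSelection u τ t)
    (hb : IsWorstSelection u (insert x τ) b) (hi : b i ≠ x) : b i = t i := by
  have hmem : b i ∈ τ := mem_of_mem_insert_of_ne (hb i).1 hi
  exact hu i (((hb i).2 _ (mem_insert_of_mem (ht i).1)).antisymm ((ht i).2 _ hmem))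

theorem IsApex.eq (hu : ∀ i, Injective (u i)) {t : ι → α} {k : ι} {x y : α}
    (hx : IsApex u t k x) (hy : IsApex u t k y) : x = y :=
  hu k ((hy.2 x hx.1).antisymm (hx.2 y hy.1))

theorem exists_isApex [Finite α] {t : ι → α} {k : ι} (h : ∃ y, ∀ l ≠ k, u l (t l) < u l y) :
    ∃ x, IsApex u t k x := by
  obtain ⟨x, hx, hmax⟩ :=
    Set.exists_max_image {y | ∀ l ≠ k, u l (t l) < u l y} (u k) (Set.toFinite _) h
  exact ⟨x, hx, hmax⟩

section Fintype

variable [Fintype ι]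

theorem IsPrimitiveSet.injective {B : Finset α} {b : ι → α} (hu : ∀ i, Injective (u i))
    (hB : IsPrimitiveSet u B) (hb : IsWorstSelection u B b) : Injective b := by
  classical
  have himage : univ.image b = B := by
    ext x
    simp only [mem_image, mem_univ, true_and]
    exact ⟨fun ⟨i, hi⟩ => hi ▸ (hb i).1, hB.1.exists_eq_of_mem hu hb⟩
  have hinj : Set.InjOn b (univ : Finset ι) := card_image_iff.1 (by rw [himage, hB.2, card_univ])
  rwa [coe_univ, Set.injOn_univ] at hinj

theorem IsPrimitiveSet.exists_isApex_of_insert [DecidableEq α] {τ : Finset α} {t : ι → α}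
    {x : α} (hu : ∀ i, Injective (u i)) (ht : IsWorstSelection u τ t) (hx : x ∉ τ)
    (hB : IsPrimitiveSet u (insert x τ)) :
    ∃ j k, j ≠ k ∧ t j = t k ∧ Set.InjOn t {k}ᶜ ∧ IsApex u t k x := by
  obtain ⟨b, hb⟩ := exists_isWorstSelection (u := u) (insert_nonempty x τ)
  have hinj := hB.injective hu hb
  obtain ⟨k, hk⟩ := hB.1.exists_eq_of_mem hu hb (mem_insert_self x τ)
  have hbt : ∀ l ≠ k, b l = t l := fun l hl =>
    ht.eq_of_insert hu hb fun h => hl (hinj (h.trans hk.symm))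
  obtain ⟨j, hj⟩ := hB.1.exists_eq_of_mem hu hb (mem_insert_of_mem (ht k).1)
  have hjk : j ≠ k := by
    rintro rfl
    exact hx (hk ▸ hj ▸ (ht j).1)
  refine ⟨j, k, hjk, (hbt j hjk).symm.trans hj, fun l hl m hm h => hinj ?_, fun l hl => ?_,
    fun y hy => ?_⟩
  · rw [hbt l hl, hbt m hm, h]
  · rw [← hbt l hl]
    exact ((hb l).2 x (mem_insert_self x τ)).lt_of_ne fun h => hl (hinj ((hu l h).trans hk.symm))
  · obtain ⟨i, hi⟩ := hB.1 y
    obtain rfl : i = k := by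
      by_contra hik
      exact (hi _ (mem_insert_of_mem (ht i).1)).not_gt (hy i hik)
    exact hi x (mem_insert_self x τ)

theorem IsApex.isPrimitiveSet_insert [DecidableEq α] {τ : Finset α} {t : ι → α} {j k : ι}
    {x : α} (hu : ∀ i, Injective (u i)) (hτ : IsDominantSet u τ) (hcard : #τ + 1 = Fintype.card ι)
    (ht : IsWorstSelection u τ t) (hjk : j ≠ k) (htjk : t j = t k) (hx : IsApex u t k x) :
    x ∉ τ ∧ IsPrimitiveSet u (insert x τ) := by
  have hxτ : x ∉ τ := fun h => by
    obtain ⟨l, hl⟩ : ∃ l ≠ k, t l = x := by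
      obtain ⟨i, rfl⟩ := hτ.exists_eq_of_mem hu ht h
      obtain rfl | hik := eq_or_ne i k
      exacts [⟨j, hjk, htjk⟩, ⟨i, hik, rfl⟩]
    exact (hx.1 l hl.1).ne (by rw [hl.2])
  refine ⟨hxτ, fun y => ?_, by rw [card_insert_of_notMem hxτ, hcard]⟩
  simp only [forall_mem_insert]
  by_cases hy : ∃ l ≠ k, u l y ≤ u l (t l)
  · obtain ⟨l, hl, hyl⟩ := hy
    exact ⟨l, hyl.trans (hx.1 l hl).le, fun z hz => hyl.trans ((ht l).2 z hz)⟩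
  · push Not at hy
    refine ⟨k, hx.2 y hy, fun z hz => (hx.2 y hy).trans ?_⟩
    obtain ⟨i, hi⟩ := hτ x
    obtain rfl : i = k := by
      by_contra hik
      exact (hi _ (ht i).1).not_gt (hx.1 i hik)
    exact hi z hz

theorem isPrimitiveSet_and_subset_iff [DecidableEq α] {τ B : Finset α} {t : ι → α} {j k : ι}
    (hu : ∀ i, Injective (u i)) (hτ : IsDominantSet u τ) (hcard : #τ + 1 = Fintype.card ι)
    (ht : IsWorstSelection u τ t) (hjk : j ≠ k) (htjk : t j = t k) (hinj : Set.InjOn t {k}ᶜ) :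
    IsPrimitiveSet u B ∧ τ ⊆ B ↔ ∃ x, (IsApex u t j x ∨ IsApex u t k x) ∧ insert x τ = B := by
  constructor
  · rintro ⟨hB, hτB⟩
    obtain ⟨x, hxτ, rfl⟩ := exists_eq_insert_iff.2 ⟨hτB, hcard.trans hB.2.symm⟩
    obtain ⟨j', k', -, -, hinj', hx⟩ := hB.exists_isApex_of_insert hu ht hxτ
    have hk' : k' = j ∨ k' = k := by
      by_contra! h
      exact hjk (hinj' h.1.symm h.2.symm htjk)
    obtain rfl | rfl := hk'
    exacts [⟨x, .inl hx, rfl⟩, ⟨x, .inr hx, rfl⟩]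
  · rintro ⟨x, hx | hx, rfl⟩
    · exact ⟨(hx.isPrimitiveSet_insert hu hτ hcard ht hjk.symm htjk.symm).2, subset_insert x τ⟩
    · exact ⟨(hx.isPrimitiveSet_insert hu hτ hcard ht hjk htjk).2, subset_insert x τ⟩

open scoped Classical in
theorem even_card_isPrimitiveSet_superset [Fintype α] {τ : Finset α} (hu : ∀ i, Injective (u i))
    (hτ : τ.Nonempty) (hcard : #τ + 1 = Fintype.card ι)
    (habove : ∀ k, ∃ y, ∀ l ≠ k, ∃ x ∈ τ, u l x < u l y) :
    Even #{B | IsPrimitiveSet u B ∧ τ ⊆ B} := by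
  obtain hempty | ⟨B, hB⟩ :=
    ({B | IsPrimitiveSet u B ∧ τ ⊆ B} : Finset (Finset α)).eq_empty_or_nonempty
  · rw [hempty, card_empty]
    exact Even.zero
  obtain ⟨hB, hτB⟩ := (mem_filter_univ B).1 hB
  have hdom : IsDominantSet u τ := hB.1.mono hτB
  obtain ⟨t, ht⟩ := exists_isWorstSelection (u := u) hτ
  obtain ⟨x, hxτ, rfl⟩ := exists_eq_insert_iff.2 ⟨hτB, hcard.trans hB.2.symm⟩
  obtain ⟨j, k, hjk, htjk, hinj, hx⟩ := hB.exists_isApex_of_insert hu ht hxτ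
  obtain ⟨x', hx'⟩ : ∃ x', IsApex u t j x' := exists_isApex <| by
    obtain ⟨y, hy⟩ := habove j
    refine ⟨y, fun l hl => ?_⟩
    obtain ⟨z, hz, hzy⟩ := hy l hl
    exact ((ht l).2 z hz).trans_lt hzy
  have hne : x ≠ x' := by
    rintro rfl
    obtain ⟨i, hi⟩ := hdom x
    obtain rfl | hik := eq_or_ne i k
    · exact (hi _ (ht i).1).not_gt (hx'.1 i hjk.symm)
    · exact (hi _ (ht i).1).not_gt (hx.1 i hik)
  have hpair : ({B | IsPrimitiveSet u B ∧ τ ⊆ B} : Finset (Finset α)) =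
      {insert x τ, insert x' τ} := by
    ext B
    simp only [mem_filter_univ, isPrimitiveSet_and_subset_iff hu hdom hcard ht hjk htjk hinj,
      mem_insert, mem_singleton]
    constructor
    · rintro ⟨z, hz | hz, rfl⟩
      exacts [.inr (by rw [hz.eq hu hx']), .inl (by rw [hz.eq hu hx])]
    · rintro (rfl | rfl)
      exacts [⟨x, .inr hx, rfl⟩, ⟨x', .inl hx', rfl⟩]
  rw [hpair, card_pair fun h => hne ((insert_inj hxτ).1 h)]
  exact even_two

/-- With respect to a colouring `c`, a set of `Fintype.card ι - 1` points whose colours are exactly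
those different from `i`. -/
def IsAlmostRainbow [DecidableEq ι] (c : α → ι) (i : ι) (τ : Finset α) : Prop :=
  #τ + 1 = Fintype.card ι ∧ τ.image c = univ.erase i

theorem IsAlmostRainbow.injOn [DecidableEq ι] {c : α → ι} {i : ι} {τ : Finset α}
    (hτ : IsAlmostRainbow c i τ) :
    Set.InjOn c τ := by
  have := card_erase_add_one (mem_univ i)
  rw [← hτ.2, card_univ, ← hτ.1] at this
  exact card_image_iff.1 (Nat.succ_injective this)

theorem isAlmostRainbow_and_subset_iff_of_image_eq_univ [DecidableEq ι] [DecidableEq α]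
    {c : α → ι} {i : ι} {B τ : Finset α} {x : α} (hB : #B = Fintype.card ι)
    (hc : B.image c = univ) (hx : x ∈ B) (hxi : c x = i) :
    IsAlmostRainbow c i τ ∧ τ ⊆ B ↔ τ = B.erase x := by
  have hcard : #(B.erase x) + 1 = Fintype.card ι := by rw [card_erase_add_one hx, hB]
  constructor
  · rintro ⟨hτ, hτB⟩
    refine eq_of_subset_of_card_le (subset_erase.2 ⟨hτB, fun hxτ => ?_⟩) (by have := hτ.1; omega)
    exact notMem_erase i univ (hτ.2 ▸ hxi ▸ mem_image_of_mem c hxτ)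
  · rintro rfl
    have hinj : Set.InjOn c B := card_image_iff.1 (by rw [hc, card_univ, hB])
    refine ⟨⟨hcard, ?_⟩, erase_subset x B⟩
    rw [← sdiff_singleton_eq_erase, image_sdiff_of_injOn hinj (singleton_subset_iff.2 hx), hc,
      image_singleton, hxi, sdiff_singleton_eq_erase]

theorem IsAlmostRainbow.and_subset_insert_iff [DecidableEq ι] [DecidableEq α] {c : α → ι} {i : ι}
    {τ σ : Finset α} {x y : α} (hτ : IsAlmostRainbow c i τ) (hx : x ∉ τ) (hy : y ∈ τ)
    (hxy : c x = c y) :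
    IsAlmostRainbow c i σ ∧ σ ⊆ insert x τ ↔ σ = τ ∨ σ = (insert x τ).erase y := by
  have hyB : y ∈ insert x τ := mem_insert_of_mem hy
  have hcardB : #(insert x τ) = Fintype.card ι := by rw [card_insert_of_notMem hx, hτ.1]
  constructor
  · rintro ⟨hσ, hσB⟩
    obtain ⟨z, hzσ, hz⟩ := exists_eq_insert_iff.2 ⟨hσB, hσ.1.trans hcardB.symm⟩
    obtain rfl : σ = (insert x τ).erase z := by rw [← hz, erase_insert hzσ]
    obtain rfl | hzx := eq_or_ne z x
    · exact .inl (erase_insert hx)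
    obtain rfl | hzy := eq_or_ne z y
    · exact .inr rfl
    have hxσ := mem_erase.2 ⟨hzx.symm, mem_insert_self x τ⟩
    have := hσ.injOn hxσ (mem_erase.2 ⟨hzy.symm, hyB⟩) hxy
    exact absurd (this ▸ hy) hx
  · rintro (rfl | rfl)
    · exact ⟨hτ, subset_insert x σ⟩
    refine ⟨⟨by rw [card_erase_add_one hyB, hcardB], ?_⟩, erase_subset y _⟩
    rw [← hτ.2, erase_insert_of_ne (ne_of_mem_of_not_mem hy hx).symm, image_insert, hxy,
      ← image_insert, insert_erase hy]

open scoped Classical in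
theorem odd_card_isAlmostRainbow_subset_iff [Fintype α] {c : α → ι} {B : Finset α} (i : ι)
    (hB : #B = Fintype.card ι) :
    Odd #{τ | IsAlmostRainbow c i τ ∧ τ ⊆ B} ↔ B.image c = univ := by
  constructor
  · contrapose
    rw [Nat.not_odd_iff_even]
    intro hc
    obtain hempty | ⟨τ, hmem⟩ :=
      ({τ | IsAlmostRainbow c i τ ∧ τ ⊆ B} : Finset (Finset α)).eq_empty_or_nonempty
    · rw [hempty, card_empty]
      exact Even.zero
    obtain ⟨hτ, hτB⟩ := (mem_filter_univ τ).1 hmem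
    obtain ⟨x, hxτ, rfl⟩ := exists_eq_insert_iff.2 ⟨hτB, hτ.1.trans hB.symm⟩
    have hxi : c x ≠ i := fun h => hc <| by
      rw [image_insert, hτ.2, h, insert_erase (mem_univ i)]
    obtain ⟨y, hy, hyx⟩ := mem_image.1 (hτ.2 ▸ mem_erase.2 ⟨hxi, mem_univ (c x)⟩)
    have hpair : ({σ | IsAlmostRainbow c i σ ∧ σ ⊆ insert x τ} : Finset (Finset α)) =
        {τ, (insert x τ).erase y} := by
      ext σ
      rw [mem_filter_univ, hτ.and_subset_insert_iff hxτ hy hyx.symm, mem_insert, mem_singleton]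
    rw [hpair, card_pair (ne_of_mem_of_not_mem' hy (notMem_erase y _))]
    exact even_two
  · intro hc
    obtain ⟨x, hx, hxi⟩ := mem_image.1 (hc ▸ mem_univ i)
    have hsingle : ({τ | IsAlmostRainbow c i τ ∧ τ ⊆ B} : Finset (Finset α)) = {B.erase x} := by
      ext τ
      rw [mem_filter_univ, isAlmostRainbow_and_subset_iff_of_image_eq_univ hB hc hx hxi,
        mem_singleton]
    rw [hsingle, card_singleton]
    exact odd_one

/-- Slack points for the utilities `u`: the point `s i` is worst for `u i`, and for the other
utilities it is better than all the points which are not slack. -/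
def IsSlack (u : ι → α → L) (s : ι → α) : Prop :=
  (∀ i x, u i (s i) ≤ u i x) ∧ ∀ i, ∀ x ∉ Set.range s, ∀ l ≠ i, u i x < u i (s l)

variable {s : ι → α} {i : ι}

theorem IsSlack.isPrimitiveSet_and_subset_iff [DecidableEq ι] [DecidableEq α] (hs : IsSlack u s)
    (hinj : Injective s) (hu : ∀ i, Injective (u i)) {x : α} (hx : x ∉ Set.range s)
    (hmax : ∀ y ∉ Set.range s, u i y ≤ u i x) {B : Finset α} :
    IsPrimitiveSet u B ∧ (univ.erase i).image s ⊆ B ↔ B = insert x ((univ.erase i).image s) := by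
  have hcard : #((univ.erase i).image s) + 1 = Fintype.card ι := by
    rw [card_image_of_injective _ hinj, card_erase_add_one (mem_univ i), card_univ]
  have hxs : x ∉ (univ.erase i).image s := fun h => hx (by
    obtain ⟨l, -, hl⟩ := mem_image.1 h
    exact ⟨l, hl⟩)
  constructor
  · rintro ⟨hB, hτB⟩
    obtain ⟨z, hzτ, rfl⟩ := exists_eq_insert_iff.2 ⟨hτB, hcard.trans hB.2.symm⟩
    have hlt : ∀ l, u l (s l) < u l x := fun l =>
      (hs.1 l x).lt_of_ne fun h => hx ⟨l, hu l h⟩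
    obtain ⟨l, hl⟩ := hB.1 x
    obtain rfl : l = i := by
      by_contra hli
      refine (hlt l).not_ge (hl _ (mem_insert_of_mem (mem_image_of_mem s ?_)))
      exact mem_erase.2 ⟨hli, mem_univ l⟩
    have hxz : u l x ≤ u l z := hl z (mem_insert_self z _)
    have hz : z ∉ Set.range s := by
      rintro ⟨k, rfl⟩
      obtain rfl | hkl := eq_or_ne k l
      · exact (hlt k).not_ge hxz
      · exact hzτ (mem_image_of_mem s (mem_erase.2 ⟨hkl, mem_univ k⟩))
    rw [hu l (hxz.antisymm (hmax z hz))]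
  · rintro rfl
    refine ⟨⟨fun y => ?_, by rw [card_insert_of_notMem hxs, hcard]⟩, subset_insert _ _⟩
    by_cases hy : y ∈ Set.range s
    · obtain ⟨l, rfl⟩ := hy
      exact ⟨l, fun z _ => hs.1 l z⟩
    · refine ⟨i, ?_⟩
      simp only [forall_mem_insert, forall_mem_image, mem_erase]
      exact ⟨hmax y hy, fun l hl => (hs.2 i y hy l hl.1).le⟩

open scoped Classical in
theorem IsSlack.even_card_superset [Fintype α] (hs : IsSlack u s) {c : α → ι}
    (hc : LeftInverse c s) (hu : ∀ i, Injective (u i)) {τ : Finset α}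
    (hτ : IsAlmostRainbow c i τ) (hne : τ ≠ (univ.erase i).image s) :
    Even #{B | IsPrimitiveSet u B ∧ τ ⊆ B} := by
  obtain ⟨x, hxτ, hx⟩ : ∃ x ∈ τ, x ∉ Set.range s := by
    by_contra! h
    refine hne (eq_of_subset_of_card_le (fun x hx => ?_) ?_)
    · obtain ⟨l, rfl⟩ := h x hx
      rw [hc.injective.mem_finset_image, ← hτ.2, ← hc l]
      exact mem_image_of_mem c hx
    · have := hτ.1
      rw [card_image_of_injective _ hc.injective, ← hτ.2]
      exact card_image_le
  exact even_card_isPrimitiveSet_superset hu ⟨x, hxτ⟩ hτ.1 fun k =>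
    ⟨s k, fun l hl => ⟨x, hxτ, hs.2 l x hx k hl.symm⟩⟩

open scoped Classical in
theorem IsSlack.exists_isPrimitiveSet_image_eq_univ [Nonempty ι] [Finite α] (hs : IsSlack u s)
    {c : α → ι} (hc : LeftInverse c s) (hu : ∀ i, Injective (u i)) (hrange : ∃ x, x ∉ Set.range s) :
    ∃ B, IsPrimitiveSet u B ∧ B.image c = univ := by
  have := Fintype.ofFinite α
  let i : ι := Classical.arbitrary ι
  let slackFacet : Finset α := (univ.erase i).image s
  have hslackFacet : IsAlmostRainbow c i slackFacet := by
    refine ⟨?_, by simp [slackFacet, image_image, hc.comp_eq_id]⟩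
    rw [card_image_of_injective _ hc.injective, card_erase_add_one (mem_univ i), card_univ]
  obtain ⟨x, hx, hmax⟩ := Set.exists_max_image (Set.range s)ᶜ (u i) (Set.toFinite _) hrange
  have hone : #{B | IsPrimitiveSet u B ∧ slackFacet ⊆ B} = 1 := by
    simp only [slackFacet, hs.isPrimitiveSet_and_subset_iff hc.injective hu hx hmax]
    rw [filter_eq', if_pos (mem_univ _), card_singleton]
  have hfacets : Odd (∑ τ with IsAlmostRainbow c i τ, #{B | IsPrimitiveSet u B ∧ τ ⊆ B}) := by
    rw [← add_sum_erase _ _ ((mem_filter_univ slackFacet).2 hslackFacet), hone]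
    refine odd_one.add_even (even_sum _ fun τ hτ => ?_)
    obtain ⟨hne, hτ⟩ := mem_erase.1 hτ
    exact hs.even_card_superset hc hu ((mem_filter_univ τ).1 hτ) hne
  have hdouble : ∑ B with IsPrimitiveSet u B, #{τ | IsAlmostRainbow c i τ ∧ τ ⊆ B} =
      ∑ τ with IsAlmostRainbow c i τ, #{B | IsPrimitiveSet u B ∧ τ ⊆ B} := by
    simpa only [bipartiteAbove, bipartiteBelow, filter_filter] using
      sum_card_bipartiteAbove_eq_sum_card_bipartiteBelow (fun B τ : Finset α => τ ⊆ B)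
        (s := {B | IsPrimitiveSet u B}) (t := {τ | IsAlmostRainbow c i τ})
  obtain ⟨B, hB⟩ := card_pos.1 ((odd_sum_iff_odd_card_odd _).1 (hdouble ▸ hfacets)).pos
  obtain ⟨hB, hodd⟩ := mem_filter.1 hB
  have hB := (mem_filter_univ B).1 hB
  exact ⟨B, hB, (odd_card_isAlmostRainbow_subset_iff i hB.2).1 hodd⟩

end Fintype

theorem exists_dominant_rainbow_selection {T : Type*} [Finite T] [Finite ι] (u : ι → T → L)
    (c : T → ι) :
    ∃ (C : Finset ι) (q : C → T),
      (∀ j, c (q j) = j) ∧ ∀ y, ∃ i : C, ∀ j : C, u i y ≤ u i (q j) := by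
  classical
  cases isEmpty_or_nonempty T
  · exact ⟨∅, fun j => (notMem_empty _ j.2).elim, fun j => (notMem_empty _ j.2).elim, isEmptyElim⟩
  have := Fintype.ofFinite T
  have := Fintype.ofFinite ι
  have : Nonempty ι := .map c inferInstance
  -- One slack point per utility is added to `T`; the second component of `w` breaks ties.
  let v : ι → T ⊕ ι → WithBot (WithTop L) := fun i =>
    Sum.elim (fun x => ((u i x : WithTop L) : WithBot (WithTop L))) fun l => if l = i then ⊥ else ⊤
  let w : ι → T ⊕ ι → WithBot (WithTop L) ×ₗ Fin (Fintype.card (T ⊕ ι)) := fun i z =>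
    toLex (v i z, Fintype.equivFin _ z)
  have hw : ∀ i, Injective (w i) := fun i z z' h =>
    (Fintype.equivFin _).injective (congrArg Prod.snd (toLex.injective h))
  have hvw : ∀ {i z z'}, v i z < v i z' → w i z < w i z' := fun h =>
    Prod.Lex.toLex_lt_toLex.2 (.inl h)
  have hslack : IsSlack w Sum.inr := by
    refine ⟨fun i z => ?_, fun i z hz l hl => ?_⟩
    · obtain x | l := z
      · exact (hvw (by simp [v])).le
      · obtain rfl | hl := eq_or_ne l i
        · exact le_rfl
        · exact (hvw (by simp [v, hl])).le
    · obtain x | m := z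
      · exact hvw (by simpa [v, hl] using WithBot.coe_lt_coe.2 (WithTop.coe_lt_top (u i x)))
      · exact (hz ⟨m, rfl⟩).elim
  obtain ⟨B, hB, hcB⟩ := hslack.exists_isPrimitiveSet_image_eq_univ (c := Sum.elim c id)
    (fun _ => rfl) hw ⟨.inl (Classical.arbitrary T), by simp⟩
  have hordinary : ∀ j : ({j | .inr j ∉ B} : Finset ι), ∃ x, .inl x ∈ B ∧ c x = j := by
    rintro ⟨j, hj⟩
    obtain ⟨x | l, hzB, hz⟩ := mem_image.1 (hcB ▸ mem_univ j)
    · exact ⟨x, hzB, hz⟩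
    · exact ((mem_filter_univ j).1 hj (hz ▸ hzB)).elim
  choose q hqB hqc using hordinary
  refine ⟨_, q, hqc, fun y => ?_⟩
  obtain ⟨i, hi⟩ := hB.1 (.inl y)
  have hle : ∀ z ∈ B, v i (.inl y) ≤ v i z := fun z hz => not_lt.1 fun h => (hvw h).not_ge (hi z hz)
  have hiB : Sum.inr i ∉ B := fun h => by simpa [v] using hle _ h
  exact ⟨⟨i, (mem_filter_univ i).2 hiB⟩, fun j => by simpa [v] using hle _ (hqB j)⟩

end Scarf

section StandardSimplex

variable {ι : Type*} [Fintype ι]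

theorem one_le_sum_of_forall_stdSimplex_exists_le [Nonempty ι] {C : Finset ι} {m : ι → ℝ}
    (hm : ∀ i ∈ C, 0 ≤ m i) (h : ∀ y : stdSimplex ℝ ι, ∃ i ∈ C, y i ≤ m i) : 1 ≤ ∑ i ∈ C, m i := by
  classical
  by_contra! hlt
  obtain ⟨i₀, hi₀, -⟩ := h (Classical.arbitrary _)
  have hC : (0 : ℝ) < C.card := by exact_mod_cast Finset.card_pos.2 ⟨i₀, hi₀⟩
  set ε := (1 - ∑ i ∈ C, m i) / C.card with hε
  have hεpos : 0 < ε := div_pos (sub_pos.2 hlt) hC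
  have hy : (fun i => if i ∈ C then m i + ε else 0) ∈ stdSimplex ℝ ι := by
    refine ⟨fun i => ?_, ?_⟩
    · dsimp only
      split_ifs with hi
      exacts [add_nonneg (hm i hi) hεpos.le, le_rfl]
    · rw [Finset.sum_ite_mem, Finset.univ_inter, Finset.sum_add_distrib, Finset.sum_const,
        nsmul_eq_mul, hε, mul_div_cancel₀ _ hC.ne', add_sub_cancel]
  obtain ⟨i, hi, hle⟩ := h ⟨_, hy⟩
  have : m i + ε ≤ m i := (if_pos hi).symm.trans_le hle
  linarith

theorem stdSimplex_apply_eq_of_le_of_one_le_sum {C : Finset ι} {m : ι → ℝ} (hm : 1 ≤ ∑ i ∈ C, m i)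
    {x : stdSimplex ℝ ι} (hx : ∀ i ∈ C, m i ≤ x i) :
    (∀ i ∈ C, x i = m i) ∧ ∀ i ∉ C, x i = 0 := by
  classical
  have hle : ∑ i ∈ C, x i ≤ 1 := by
    rw [← stdSimplex.sum_eq_one x]
    exact Finset.sum_le_sum_of_subset_of_nonneg C.subset_univ fun i _ _ => stdSimplex.zero_le x i
  have hsum := Finset.sum_le_sum hx
  have hcompl : ∑ i ∈ Cᶜ, x i = 0 := by
    have := Finset.sum_add_sum_compl C x
    rw [stdSimplex.sum_eq_one] at this
    linarith
  refine ⟨fun i hi => ((Finset.sum_eq_sum_iff_of_le hx).1 (by linarith) i hi).symm, fun i hi => ?_⟩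
  exact (Finset.sum_eq_zero_iff_of_nonneg fun i _ => stdSimplex.zero_le x i).1 hcompl i
    (Finset.mem_compl.2 hi)

theorem exists_forall_eq_of_forall_stdSimplex_exists_le [Nonempty ι] {C : Finset ι}
    {q : C → stdSimplex ℝ ι} (hq : ∀ y : stdSimplex ℝ ι, ∃ i : C, ∀ j, y i ≤ q j i) :
    ∃ p : stdSimplex ℝ ι, (∀ j, q j = p) ∧ ∀ i ∉ C, p i = 0 := by
  obtain ⟨i₀, -⟩ := hq (Classical.arbitrary _)
  have : Nonempty C := ⟨i₀⟩
  choose worst hworst using fun i => Finite.exists_min fun j => q j i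
  have hsum : 1 ≤ ∑ i ∈ C, q (worst i) i :=
    one_le_sum_of_forall_stdSimplex_exists_le (fun i _ => stdSimplex.zero_le _ i) fun y => by
      obtain ⟨i, hi⟩ := hq y
      exact ⟨i, i.2, hi _⟩
  have heq := fun j => stdSimplex_apply_eq_of_le_of_one_le_sum (x := q j) hsum fun i _ => hworst i j
  refine ⟨q i₀, fun j => stdSimplex.ext (funext fun i => ?_), (heq i₀).2⟩
  by_cases hi : i ∈ C
  · rw [(heq j).1 i hi, (heq i₀).1 i hi]
  · rw [(heq j).2 i hi, (heq i₀).2 i hi]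

theorem continuous_stdSimplex_apply (i : ι) : Continuous fun x : stdSimplex ℝ ι => x i :=
  (continuous_apply i).comp continuous_subtype_val

theorem nonempty_iInter_of_isClosed_of_facet_subset [Nonempty ι] {F : ι → Set (stdSimplex ℝ ι)}
    (hclosed : ∀ i, IsClosed (F i)) (hcover : ∀ x, ∃ i, x ∈ F i)
    (hfacet : ∀ i x, x i = 0 → x ∈ F i) : (⋂ i, F i).Nonempty := by
  -- `Z y` holds the selections dominating `y`; a point in all of them comes from compactness.
  let Z : stdSimplex ℝ ι → Set (Σ C : Finset ι, (C → stdSimplex ℝ ι)) := fun y =>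
    {z | (∀ j : z.1, z.2 j ∈ F j) ∧ ∃ i : z.1, ∀ j, y i ≤ z.2 j i}
  have hZ : ∀ y, IsClosed (Z y) := fun y => isClosed_sigma_iff.2 fun C => by
    have hF : IsClosed {q : C → stdSimplex ℝ ι | ∀ j : C, q j ∈ F j} := by
      simp only [Set.ofPred_forall]
      exact isClosed_iInter fun j => (hclosed j).preimage (continuous_apply j)
    have hy : IsClosed {q : C → stdSimplex ℝ ι | ∃ i : C, ∀ j, y i ≤ q j i} := by
      simp only [Set.ofPred_exists, Set.ofPred_forall]
      exact isClosed_iUnion_of_finite fun i => isClosed_iInter fun j =>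
        isClosed_le continuous_const ((continuous_stdSimplex_apply _).comp (continuous_apply j))
    exact hF.inter hy
  choose c hc using hcover
  obtain ⟨⟨C, q⟩, hCq⟩ := CompactSpace.iInter_nonempty hZ fun s => by
    obtain ⟨C, q, hqc, hq⟩ := exists_dominant_rainbow_selection (fun i (x : s) => x.1 i)
      fun x : s => c x
    refine ⟨⟨C, fun j => q j⟩, Set.mem_iInter₂.2 fun y hy => ⟨fun j => ?_, hq ⟨y, hy⟩⟩⟩
    simpa only [hqc] using hc (q j)
  rw [Set.mem_iInter] at hCq
  obtain ⟨p, hp, hp0⟩ := exists_forall_eq_of_forall_stdSimplex_exists_le fun y => (hCq y).2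
  refine ⟨p, Set.mem_iInter.2 fun i => ?_⟩
  by_cases hi : i ∈ C
  · exact hp ⟨i, hi⟩ ▸ (hCq p).1 ⟨i, hi⟩
  · exact hfacet i p (hp0 i hi)

theorem stdSimplex_eq_of_forall_le {x y : stdSimplex ℝ ι} (h : ∀ i, x i ≤ y i) : x = y :=
  stdSimplex.ext <| funext fun i => (Finset.sum_eq_sum_iff_of_le fun i _ => h i).1
    (by rw [stdSimplex.sum_eq_one, stdSimplex.sum_eq_one]) i (Finset.mem_univ i)

theorem stdSimplex_surjective_of_mapsTo_facets {h : stdSimplex ℝ ι → stdSimplex ℝ ι}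
    (hh : Continuous h) (hfacet : ∀ x i, x i = 0 → h x i = 0) : Function.Surjective h := by
  intro y
  have hsum : ∀ x : stdSimplex ℝ ι, ∑ i, x i = ∑ i, y i := fun x => by
    rw [stdSimplex.sum_eq_one, stdSimplex.sum_eq_one]
  have : Nonempty ι := by
    by_contra hι
    rw [not_nonempty_iff] at hι
    simpa using stdSimplex.sum_eq_one y
  obtain ⟨x, hx⟩ := nonempty_iInter_of_isClosed_of_facet_subset (F := fun i => {x | h x i ≤ y i})
    (fun i => isClosed_le ((continuous_stdSimplex_apply i).comp hh) continuous_const)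
    (fun x => by
      obtain ⟨i, -, hi⟩ := Finset.exists_le_of_sum_le Finset.univ_nonempty (hsum (h x)).le
      exact ⟨i, hi⟩)
    fun i x hx => (hfacet x i hx).trans_le (stdSimplex.zero_le y i)
  exact ⟨x, stdSimplex_eq_of_forall_le (Set.mem_iInter.1 hx)⟩

end StandardSimplex

section Selection

variable {A X : Type*} [Fintype A] [DecidableEq A] {γ : A → X → ℝ} {S : Finset A} {x : X}

/-- A weight at `x` for each set `S` of indices, positive when the members of `S` have positive
values `γ a x` exceeding all the other values. The maximal values then belong to every nonempty `S`
of positive weight. -/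
noncomputable def dominanceWeight (γ : A → X → ℝ) (S : Finset A) (x : X) : ℝ :=
  ∏ a ∈ S, ((γ a x)⁺ * ∏ b ∈ Sᶜ, (γ a x - γ b x)⁺)

theorem dominanceWeight_nonneg : 0 ≤ dominanceWeight γ S x :=
  Finset.prod_nonneg fun _ _ =>
    mul_nonneg (posPart_nonneg _) (Finset.prod_nonneg fun _ _ => posPart_nonneg _)

theorem dominanceWeight_ne_zero_iff :
    dominanceWeight γ S x ≠ 0 ↔ ∀ a ∈ S, 0 < γ a x ∧ ∀ b ∉ S, γ b x < γ a x := by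
  simp only [dominanceWeight, Finset.prod_ne_zero_iff, mul_ne_zero_iff, ne_eq, posPart_eq_zero,
    not_le, Finset.mem_compl, sub_pos]

theorem continuous_dominanceWeight [TopologicalSpace X] (hγ : ∀ a, Continuous (γ a)) :
    Continuous (dominanceWeight γ S) := by
  have : Continuous fun r : ℝ => r⁺ := continuous_posPart
  unfold dominanceWeight
  fun_prop

theorem sum_dominanceWeight_pos (hx : ∃ a, 0 < γ a x) :
    0 < ∑ S : Finset A with S.Nonempty, dominanceWeight γ S x := by
  obtain ⟨a, ha⟩ := hx
  let S : Finset A := {b | 0 < γ b x}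
  have hmem : ∀ b, b ∈ S ↔ 0 < γ b x := fun b => Finset.mem_filter_univ b
  have hS : dominanceWeight γ S x ≠ 0 := dominanceWeight_ne_zero_iff.2 fun b hb =>
    ⟨(hmem b).1 hb, fun b' hb' => (not_lt.1 (mt (hmem b').2 hb')).trans_lt ((hmem b).1 hb)⟩
  exact Finset.sum_pos' (fun _ _ => dominanceWeight_nonneg)
    ⟨S, Finset.mem_filter.2 ⟨Finset.mem_univ S, a, (hmem a).2 ha⟩,
      dominanceWeight_nonneg.lt_of_ne' hS⟩

variable {E : Type*} [AddCommGroup E] [Module ℝ E] {F : A → Set E}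

theorem exists_centerMass_dominanceWeight_mem (hF : ∀ a, Convex ℝ (F a)) {p : Finset A → E}
    (hp : ∀ S : Finset A, S.Nonempty → dominanceWeight γ S x ≠ 0 → ∀ a ∈ S, p S ∈ F a)
    (hx : ∃ a, 0 < γ a x) :
    ∃ a, 0 < γ a x ∧
      Finset.centerMass {S | S.Nonempty} (fun S => dominanceWeight γ S x) p ∈ F a := by
  have : Nonempty A := hx.nonempty
  obtain ⟨a, ha⟩ := Finite.exists_max fun a => γ a x
  have hmem : ∀ S : Finset A, S.Nonempty → dominanceWeight γ S x ≠ 0 → a ∈ S := by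
    rintro S ⟨b, hb⟩ hS
    by_contra haS
    exact ((dominanceWeight_ne_zero_iff.1 hS b hb).2 a haS).not_ge (ha b)
  refine ⟨a, hx.elim fun b hb => hb.trans_le (ha b), ?_⟩
  rw [← Finset.centerMass_filter_ne_zero]
  refine (hF a).centerMass_mem (fun _ _ => dominanceWeight_nonneg) ?_ fun S hS => ?_
  · rw [Finset.sum_filter_ne_zero]
    exact sum_dominanceWeight_pos hx
  · obtain ⟨hS, hweight⟩ := Finset.mem_filter.1 hS
    have hS : S.Nonempty := (Finset.mem_filter_univ S).1 hS
    exact hp S hS hweight a (hmem S hS hweight)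

end Selection

theorem exists_continuous_forall_exists_pos_and_mem {A X E : Type*} [Finite A] [TopologicalSpace X]
    [AddCommGroup E] [Module ℝ E] [TopologicalSpace E] [ContinuousAdd E] [ContinuousSMul ℝ E]
    {γ : A → X → ℝ} {F : A → Set E} (hγ : ∀ a, Continuous (γ a))
    (hcover : ∀ x, ∃ a, 0 < γ a x) (hF : ∀ a, Convex ℝ (F a))
    (hinter : ∀ x, ∀ S : Finset A, S.Nonempty → (∀ a ∈ S, 0 < γ a x) → (⋂ a ∈ S, F a).Nonempty) :
    ∃ g : X → E, Continuous g ∧ ∀ x, ∃ a, 0 < γ a x ∧ g x ∈ F a := by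
  classical
  have := Fintype.ofFinite A
  have hpoint : ∀ S : Finset A, ∃ p : E, S.Nonempty → ∀ x, dominanceWeight γ S x ≠ 0 →
      ∀ a ∈ S, p ∈ F a := by
    intro S
    by_cases hS : S.Nonempty ∧ ∃ x, dominanceWeight γ S x ≠ 0
    · obtain ⟨hS, x, hx⟩ := hS
      obtain ⟨p, hp⟩ := hinter x S hS fun a ha => (dominanceWeight_ne_zero_iff.1 hx a ha).1
      exact ⟨p, fun _ _ _ => Set.mem_iInter₂.1 hp⟩
    · exact ⟨0, fun h x hx => (hS ⟨h, x, hx⟩).elim⟩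
  choose p hp using hpoint
  have hw : ∀ S, Continuous (dominanceWeight γ S) := fun S => continuous_dominanceWeight hγ
  let g : X → E := fun x =>
    Finset.centerMass {S : Finset A | S.Nonempty} (fun S => dominanceWeight γ S x) p
  have hg : Continuous g :=
    ((continuous_finsetSum _ fun S _ => hw S).inv₀ fun x =>
      (sum_dominanceWeight_pos (hcover x)).ne').smul
        (continuous_finsetSum _ fun S _ => (hw S).smul continuous_const)
  exact ⟨g, hg, fun x =>
    exists_centerMass_dominanceWeight_mem hF (fun S hS => hp S hS x) (hcover x)⟩

section CoordinateGap

variable {ι : Type*} [Fintype ι] [DecidableEq ι] {x : ι → ℝ} {J K : Finset ι}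

/-- A continuous function of `x`, positive if and only if every coordinate with index in `J` is
smaller than every other coordinate. -/
noncomputable def coordinateGap (J : Finset ι) (x : ι → ℝ) : ℝ :=
  ∏ i ∈ J, ∏ j ∈ Jᶜ, (x j - x i)⁺

theorem continuous_coordinateGap (J : Finset ι) : Continuous (coordinateGap J) := by
  have : Continuous fun r : ℝ => r⁺ := continuous_posPart
  unfold coordinateGap
  fun_prop

theorem coordinateGap_pos_iff : 0 < coordinateGap J x ↔ ∀ i ∈ J, ∀ j ∉ J, x i < x j := by
  have hnonneg : 0 ≤ coordinateGap J x :=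
    Finset.prod_nonneg fun _ _ => Finset.prod_nonneg fun _ _ => posPart_nonneg _
  rw [hnonneg.lt_iff_ne']
  simp only [coordinateGap, Finset.prod_ne_zero_iff, ne_eq, posPart_eq_zero, not_le,
    Finset.mem_compl, sub_pos]

theorem subset_or_subset_of_coordinateGap_pos (hJ : 0 < coordinateGap J x)
    (hK : 0 < coordinateGap K x) : J ⊆ K ∨ K ⊆ J := by
  by_contra! h
  obtain ⟨⟨i, hiJ, hiK⟩, ⟨j, hjK, hjJ⟩⟩ := h.imp Finset.not_subset.1 Finset.not_subset.1
  exact lt_asymm (coordinateGap_pos_iff.1 hJ i hiJ j hjJ) (coordinateGap_pos_iff.1 hK j hjK i hiK)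

theorem mem_of_coordinateGap_pos (hx : 0 ≤ x) (hJ : J.Nonempty) (hgap : 0 < coordinateGap J x)
    {i : ι} (hi : x i = 0) : i ∈ J := by
  by_contra hiJ
  obtain ⟨j, hj⟩ := hJ
  exact ((coordinateGap_pos_iff.1 hgap j hj i hiJ).trans_eq hi).not_ge (hx j)

theorem coordinateGap_filter_eq_zero_pos (hx : 0 ≤ x) :
    0 < coordinateGap {i | x i = 0} x := by
  refine coordinateGap_pos_iff.2 fun i hi j hj => ?_
  rw [(Finset.mem_filter_univ i).1 hi]
  exact (hx j).lt_of_ne' fun h => hj ((Finset.mem_filter_univ j).2 h)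

end CoordinateGap

namespace NestedSeq

variable {n : ℕ}

/-- The nested sequence with `J` as its only member. -/
def single (J : Finset (Fin (n + 1))) (hne : J ≠ ∅) (huniv : J ≠ Finset.univ) : NestedSeq n where
  sets := {J}
  nonempty := Finset.singleton_nonempty J
  chain := by simp
  ne_empty := by simpa using hne
  ne_univ := by simpa using huniv

theorem largest_single (J : Finset (Fin (n + 1))) (hne : J ≠ ∅) (huniv : J ≠ Finset.univ) :
    (single J hne huniv).largest = J :=
  Finset.sup_singleton

theorem le_single_iff {I : NestedSeq n} {J : Finset (Fin (n + 1))} (hne : J ≠ ∅)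
    (huniv : J ≠ Finset.univ) : I ≤ single J hne huniv ↔ J ∈ I.sets :=
  Finset.singleton_subset_iff

variable {E : Type*} {face : NestedSeq n → Set E} {C : Set E}

/-- The index type of the sets `C` and `face (single J)`, for the nonempty proper subsets `J`; the
index `none` stands for `C`. -/
abbrev MaximalFaceIndex (n : ℕ) : Type :=
  Option {J : Finset (Fin (n + 1)) // J ≠ ∅ ∧ J ≠ Finset.univ}

/-- The set with a given index: `C` itself, or a face labelled by a one-member sequence. -/
def maximalFace (face : NestedSeq n → Set E) (C : Set E) : MaximalFaceIndex n → Set E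
  | none => C
  | some J => face (single J.1 J.2.1 J.2.2)

/-- The functions on the simplex which select among the sets `maximalFace face C a`: the index
`none` is allowed in the interior only, and `some J` only where the coordinates in `J` are smaller
than the others. -/
noncomputable def selector : MaximalFaceIndex n → stdSimplex ℝ (Fin (n + 1)) → ℝ
  | none => fun x => ∏ i, x i
  | some J => fun x => coordinateGap J.1 x

theorem continuous_selector (a : MaximalFaceIndex n) : Continuous (selector a) := by
  cases a with
  | none =>
    exact continuous_finsetProd _ fun i _ => continuous_stdSimplex_apply i
  | some J => exact (continuous_coordinateGap J.1).comp continuous_subtype_val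

theorem exists_selector_pos (x : stdSimplex ℝ (Fin (n + 1))) : ∃ a, 0 < selector a x := by
  by_cases hx : ∃ i, x i = 0
  · obtain ⟨i, hi⟩ := hx
    let J : Finset (Fin (n + 1)) := {i | x i = 0}
    have hne : J ≠ ∅ := Finset.ne_empty_of_mem ((Finset.mem_filter_univ i).2 hi)
    have huniv : J ≠ Finset.univ := fun h => zero_ne_one <|
      (Finset.sum_eq_zero fun i _ => (Finset.filter_eq_self.1 h) i (Finset.mem_univ i)).symm.trans
        x.2.2
    exact ⟨some ⟨J, hne, huniv⟩, coordinateGap_filter_eq_zero_pos x.2.1⟩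
  · push Not at hx
    exact ⟨none, Finset.prod_pos fun i _ => (x.2.1 i).lt_of_ne' (hx i)⟩

theorem nonempty_iInter_maximalFace (hmono : Monotone face) (hne : ∀ I, (face I).Nonempty)
    (hsub : ∀ I, face I ⊆ C) (hC : C.Nonempty) {S : Finset (MaximalFaceIndex n)}
    {x : stdSimplex ℝ (Fin (n + 1))} (hS : ∀ a ∈ S, 0 < selector a x) :
    (⋂ a ∈ S, maximalFace face C a).Nonempty := by
  rcases S.eraseNone.eq_empty_or_nonempty with hempty | hnonempty
  · obtain ⟨p, hp⟩ := hC
    refine ⟨p, Set.mem_iInter₂.2 fun a ha => ?_⟩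
    cases a with
    | none => exact hp
    | some J => exact absurd (Finset.mem_eraseNone.2 ha) (hempty ▸ Finset.notMem_empty J)
  · have hgap : ∀ J ∈ S.eraseNone, 0 < coordinateGap J.1 x := fun J hJ =>
      hS (some J) (Finset.mem_eraseNone.1 hJ)
    let I : NestedSeq n :=
      { sets := S.eraseNone.map (Function.Embedding.subtype _)
        nonempty := hnonempty.map
        chain := by
          simp only [Finset.forall_mem_map]
          exact fun J hJ K hK => subset_or_subset_of_coordinateGap_pos (hgap J hJ) (hgap K hK)
        ne_empty := Finset.forall_mem_map.2 fun J _ => J.2.1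
        ne_univ := Finset.forall_mem_map.2 fun J _ => J.2.2 }
    obtain ⟨p, hp⟩ := hne I
    refine ⟨p, Set.mem_iInter₂.2 fun a ha => ?_⟩
    cases a with
    | none => exact hsub I hp
    | some J =>
      exact hmono ((le_single_iff J.2.1 J.2.2).2
        (Finset.mem_map_of_mem _ (Finset.mem_eraseNone.2 ha))) hp

theorem exists_continuous_mem_face_of_coord_eq_zero [AddCommGroup E] [Module ℝ E]
    [TopologicalSpace E] [ContinuousAdd E] [ContinuousSMul ℝ E] (hmono : Monotone face)
    (hconvex : ∀ I, Convex ℝ (face I)) (hne : ∀ I, (face I).Nonempty) (hsub : ∀ I, face I ⊆ C)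
    (hC : Convex ℝ C) (hCne : C.Nonempty) :
    ∃ g : stdSimplex ℝ (Fin (n + 1)) → C, Continuous g ∧
      ∀ x, (∃ i, x i = 0) → ∃ I, (g x : E) ∈ face I ∧ ∀ i, x i = 0 → i ∈ I.largest := by
  have hF : ∀ a, Convex ℝ (maximalFace face C a) := Option.rec hC fun J => hconvex _
  have hFsub : ∀ a, maximalFace face C a ⊆ C := Option.rec subset_rfl fun J => hsub _
  obtain ⟨g, hg, hgmem⟩ := exists_continuous_forall_exists_pos_and_mem continuous_selector
    exists_selector_pos hF fun x S _ => nonempty_iInter_maximalFace hmono hne hsub hCne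
  have hgC : ∀ x, g x ∈ C := fun x => (hgmem x).elim fun a ha => hFsub a ha.2
  refine ⟨fun x => ⟨g x, hgC x⟩, hg.subtype_mk hgC, fun x ⟨i, hi⟩ => ?_⟩
  obtain ⟨a, hpos, hmem⟩ := hgmem x
  cases a with
  | none => exact absurd (Finset.prod_eq_zero (Finset.mem_univ i) hi) hpos.ne'
  | some J =>
    refine ⟨single J.1 J.2.1 J.2.2, hmem, fun i hi => ?_⟩
    rw [largest_single]
    exact mem_of_coordinateGap_pos x.2.1 (Finset.nonempty_iff_ne_empty.2 J.2.1) hpos hi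

end NestedSeq

section Barycentric

variable {n : ℕ} {V : Type*} [NormedAddCommGroup V] [NormedSpace ℝ V] (s : Affine.Simplex ℝ V n)

theorem linearCombination_image_convexHull_single (t : Set (Fin (n + 1))) :
    Fintype.linearCombination ℝ s.points '' convexHull ℝ ((Pi.single · (1 : ℝ)) '' t) =
      convexHull ℝ (s.points '' t) := by
  rw [LinearMap.image_convexHull, Set.image_image]
  simp only [Fintype.linearCombination_apply_single, one_smul]

theorem injOn_linearCombination_stdSimplex :
    Set.InjOn (Fintype.linearCombination ℝ s.points) (stdSimplex ℝ (Fin (n + 1))) := by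
  intro x hx y hy hxy
  have hsum : ∑ i, (x - y) i = 0 := by
    simp only [Pi.sub_apply, Finset.sum_sub_distrib, hx.2, hy.2, sub_self]
  have hcomb : ∑ i, (x - y) i • s.points i = 0 := by
    rw [← Fintype.linearCombination_apply, map_sub, hxy, sub_self]
  exact funext fun i => sub_eq_zero.1 <|
    affineIndependent_iff.1 s.independent Finset.univ (x - y) hsum hcomb i (Finset.mem_univ i)

theorem bijOn_linearCombination_stdSimplex :
    Set.BijOn (Fintype.linearCombination ℝ s.points) (stdSimplex ℝ (Fin (n + 1)))
      (simplexBody s) := by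
  have himage :
      Fintype.linearCombination ℝ s.points '' stdSimplex ℝ (Fin (n + 1)) = simplexBody s := by
    rw [← convexHull_rangle_single_eq_stdSimplex, ← Set.image_univ,
      linearCombination_image_convexHull_single, Set.image_univ, simplexBody]
  exact himage ▸ (injOn_linearCombination_stdSimplex s).bijOn_image

/-- The homeomorphism from the standard simplex onto `simplexBody s` which maps the barycentric
coordinates of a point to this point. -/
noncomputable def simplexHomeomorph : stdSimplex ℝ (Fin (n + 1)) ≃ₜ simplexBody s :=
  Continuous.homeoOfEquivCompactToT2 (f := (bijOn_linearCombination_stdSimplex s).equiv) <|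
    ((LinearMap.continuous_of_finiteDimensional _).comp continuous_subtype_val).subtype_mk _

theorem coe_simplexHomeomorph (x : stdSimplex ℝ (Fin (n + 1))) :
    (simplexHomeomorph s x : V) = Fintype.linearCombination ℝ s.points x :=
  rfl

variable {s}

theorem simplexHomeomorph_symm_apply_eq_zero {I : Finset (Fin (n + 1))} {v : simplexBody s}
    (hv : (v : V) ∈ simplexFace s I) {i : Fin (n + 1)} (hi : i ∈ I) :
    (simplexHomeomorph s).symm v i = 0 := by
  rw [simplexFace, ← linearCombination_image_convexHull_single] at hv
  obtain ⟨x, hx, hxv⟩ := hv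
  have hsub : convexHull ℝ ((Pi.single · (1 : ℝ)) '' {i | i ∉ I}) ⊆
      stdSimplex ℝ (Fin (n + 1)) ∩ {x | x i = 0} := by
    refine convexHull_min ?_ ((convex_stdSimplex ℝ _).inter
      (convex_hyperplane (LinearMap.proj (R := ℝ) i).isLinear 0))
    rintro _ ⟨j, hj, rfl⟩
    exact ⟨single_mem_stdSimplex ℝ j, Pi.single_eq_of_ne (ne_of_mem_of_not_mem hi hj) _⟩
  have hcoord : (simplexHomeomorph s).symm v = ⟨x, (hsub hx).1⟩ :=
    (simplexHomeomorph s).symm_apply_eq.2 <| Subtype.ext <|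
      hxv.symm.trans (coe_simplexHomeomorph s ⟨x, (hsub hx).1⟩).symm
  rw [hcoord]
  exact (hsub hx).2

end Barycentric

theorem mainTheorem7_general (n : ℕ) {E : Type*} [AddCommGroup E] [Module ℝ E]
    [TopologicalSpace E] [ContinuousAdd E] [ContinuousSMul ℝ E] {C : Set E} (hC : Convex ℝ C)
    (hCne : C.Nonempty) {face : NestedSeq n → Set E} (hmono : Monotone face)
    (hconvex : ∀ I, Convex ℝ (face I)) (hne : ∀ I, (face I).Nonempty) (hsub : ∀ I, face I ⊆ C)
    {V : Type*} [NormedAddCommGroup V] [NormedSpace ℝ V] (s : Affine.Simplex ℝ V n)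
    (f : C → simplexBody s) (hf : Continuous f)
    (hface : ∀ (I : NestedSeq n) (x : C),
      (x : E) ∈ face I → (f x : V) ∈ simplexFace s I.largest) :
    Function.Surjective f := by
  obtain ⟨g, hg, hgface⟩ :=
    NestedSeq.exists_continuous_mem_face_of_coord_eq_zero hmono hconvex hne hsub hC hCne
  let e := simplexHomeomorph s
  have hsurj : Function.Surjective (e.symm ∘ f ∘ g) := by
    refine stdSimplex_surjective_of_mapsTo_facets
      (e.symm.continuous.comp (hf.comp hg)) fun x i hi => ?_
    obtain ⟨I, hI, hzero⟩ := hgface x ⟨i, hi⟩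
    exact simplexHomeomorph_symm_apply_eq_zero (hface I (g x) hI) (hzero i hi)
  exact ((e.symm.comp_surjective (f ∘ g)).1 hsurj).of_comp

namespace Permutahedron

variable {n : ℕ} {E : Type*} [NormedAddCommGroup E] [NormedSpace ℝ E] (P : Permutahedron n E)

theorem convex_carrier : Convex ℝ P.carrier := by
  obtain ⟨s, -, hs⟩ := P.isPolytope
  rw [hs]
  exact convex_convexHull ℝ s

theorem convex_face (I : NestedSeq n) : Convex ℝ (P.face I) :=
  (P.labelling I).2.1.convex P.convex_carrier

theorem face_nonempty (I : NestedSeq n) : (P.face I).Nonempty :=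
  (P.labelling I).2.2.1

theorem face_subset_carrier (I : NestedSeq n) : P.face I ⊆ P.carrier :=
  (P.labelling I).2.1.subset

theorem monotone_face : Monotone P.face :=
  fun _ _ h => P.labelling.monotone h

end Permutahedron

theorem mainTheorem7 (n : ℕ)
    {E : Type*} [NormedAddCommGroup E] [NormedSpace ℝ E] (P : Permutahedron n E)
    {V : Type*} [NormedAddCommGroup V] [NormedSpace ℝ V] (s : Affine.Simplex ℝ V n)
    (f : P.carrier → simplexBody s) (hf : Continuous f)
    (hface : ∀ (I : NestedSeq n) (x : P.carrier),
      (x : E) ∈ P.face I → (f x : V) ∈ simplexFace s I.largest) :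
    Function.Surjective f :=
  mainTheorem7_general n P.convex_carrier P.nonempty P.monotone_face P.convex_face
    P.face_nonempty P.face_subset_carrier s f hf hface
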